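/- **Stochastic evaluation of monotone $k$-DNF formulas.** An instance consists of a monotone DNF formula $f$ (a disjunction of $m\ge 0$ terms, each a possibly empty conjunction of unnegated variables) over variables $x_1,\dots,x_n$, a probability vector $p$ with $0<p_i<1$, and a real cost vector $c$ with $c_i\ge 0$. An algorithm is given the instance and must output $f(x)$ for a hidden assignment $x\in\{0,1\}^n$; it learns about $x$ only by testing variables one after the other, adaptively, where each test of $x_i$ costs $c_i$. Let $D_p$ be the product distribution with $\Pr[x_i=1]=p_i$ independently for all $i$, and let $\rho=\min_i\min(p_i,1-p_i)$ (if $n=0$, the bound below just says that the cost is $0$). A partial assignment $b\in\{0,1,*\}^n$ is a certificate of $f$ if $f$ is constant on the set of all assignments that agree with $b$ wherever $b_i\neq *$; its cost is $\sum_{i:\,b_i\ne *}c_i$; and $\mathrm{CERT}(f,x)$ is the minimum cost of a certificate of $f$ that agrees with $x$. There is a single deterministic algorithm (a program for a random access machine with unit-cost addition, subtraction and comparison of natural numbers and of real numbers, unit-cost memory and input access with computed indices, and unit-cost tests) and a polynomial $q$ such that for every instance: 1. for every $x\in\{0,1\}^n$ the algorithm outputs $f(x)$, and its total number of steps (in particular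 the time needed to determine any single next test or the final answer) is at most $q(n+m)$; 2. for every $k$ such that $f$ is a $k$-DNF (each term has at most $k$ variables), if $\mathrm{cost}(x)$ denotes the total cost of the tests performed on $x$, then $$\mathbb E_{x\sim D_p}[\mathrm{cost}(x)]\;\le\;\frac{4}{\rho^k}\;\mathbb E_{x\sim D_p}[\mathrm{CERT}(f,x)].$$ -/

import Mathlib

namespace SBFE

/-! ### Monotone DNF formulas, certificates, product distributions -/

/-- A monotone DNF formula over the variables `x_i`, `i : Fin n`: a finite sequence of terms without
negations, a term being the set of the variables whose conjunction it is. Without terms it is the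
constant `0`; an empty term is satisfied by every assignment. -/
structure MonotoneDNF (n : ℕ) where
  numTerms : ℕ
  term : Fin numTerms → Finset (Fin n)

/-- The Boolean function computed by the formula. -/
def MonotoneDNF.eval {n : ℕ} (φ : MonotoneDNF n) (x : Fin n → Bool) : Bool :=
  decide (∃ j, ∀ i ∈ φ.term j, x i = true)

/-- Every term has at most `k` literals. -/
def MonotoneDNF.IsKDNF {n : ℕ} (φ : MonotoneDNF n) (k : ℕ) : Prop :=
  ∀ j, (φ.term j).card ≤ k

/-- The assignment `x` contains the partial assignment `b` (`none` plays the role of `*`). -/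
def Contains {n : ℕ} (x : Fin n → Bool) (b : Fin n → Option Bool) : Prop :=
  ∀ i v, b i = some v → x i = v

/-- `b` is a `v`-certificate of `f`, for `v` one of the two truth values. -/
def IsCertificateFor {n : ℕ} (f : (Fin n → Bool) → Bool) (v : Bool)
    (b : Fin n → Option Bool) : Prop :=
  ∀ a, Contains a b → f a = v

/-- `b` is a 0-certificate or a 1-certificate of `f`. -/
def IsCertificate {n : ℕ} (f : (Fin n → Bool) → Bool) (b : Fin n → Option Bool) : Prop :=
  IsCertificateFor f false b ∨ IsCertificateFor f true b

/-- The cost of a partial assignment: the sum of the costs of the variables that it sets. -/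
def certificateCost {n : ℕ} (c : Fin n → ℝ) (b : Fin n → Option Bool) : ℝ :=
  ∑ i, if (b i).isSome then c i else 0

/-- The minimum cost of a certificate of `f` contained in `x`. (The infimum is over a finite set,
which is nonempty because all of `x` is a certificate contained in `x`.) -/
noncomputable def minCertificateCost {n : ℕ} (f : (Fin n → Bool) → Bool) (c : Fin n → ℝ)
    (x : Fin n → Bool) : ℝ :=
  sInf (certificateCost c '' {b | IsCertificate f b ∧ Contains x b})

/-- The probability of `x` in the product distribution in which `x_i = 1` has probability `p i`. -/
def productProb {n : ℕ} (p : Fin n → ℝ) (x : Fin n → Bool) : ℝ :=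
  ∏ i, if x i then p i else 1 - p i

/-- The expectation of `g x` for `x` drawn from the product distribution. -/
def expectation {n : ℕ} (p : Fin n → ℝ) (g : (Fin n → Bool) → ℝ) : ℝ :=
  ∑ x, productProb p x * g x

/-- An instance of the stochastic Boolean function evaluation problem for monotone DNF formulas. -/
structure Instance (n : ℕ) where
  formula : MonotoneDNF n
  prob : Fin n → ℝ
  cost : Fin n → ℝ
  prob_pos : ∀ i, 0 < prob i
  prob_lt_one : ∀ i, prob i < 1
  cost_nonneg : ∀ i, 0 ≤ cost i

/-- The smallest of the numbers `p_i` and `1 - p_i`. -/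
noncomputable def Instance.rho {n : ℕ} (I : Instance n) : ℝ :=
  ⨅ i, min (I.prob i) (1 - I.prob i)

/-- The number of variables plus the number of terms. The length of any reasonable encoding of the
instance is at least this number and at most polynomial in it. -/
def Instance.size {n : ℕ} (I : Instance n) : ℕ := n + I.formula.numTerms

/-! ### Algorithms: programs of a random access machine with integer and real memory

The working memory consists of arrays of natural numbers and arrays of real numbers, with computed
indices. A program names only finitely many arrays. The only arithmetic is addition, subtraction and
comparison, so in `t` unit-cost steps the binary length of the natural numbers that occur grows by
`O(t)` only, and the reals that occur are integer combinations of the input reals and `1`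
with coefficients of binary length `O(t)`. -/

/-- The working memory: entry `i` of the array `a` is `nat a i`, respectively `real a i`. -/
structure Memory where
  nat : ℕ → ℕ → ℕ
  real : ℕ → ℕ → ℝ

/-- At the start, all memory cells hold `0`. -/
def Memory.initial : Memory := ⟨fun _ _ => 0, fun _ _ => 0⟩

def Memory.setNat (s : Memory) (a i v : ℕ) : Memory :=
  { s with nat := Function.update s.nat a (Function.update (s.nat a) i v) }

def Memory.setReal (s : Memory) (a i : ℕ) (v : ℝ) : Memory :=
  { s with real := Function.update s.real a (Function.update (s.real a) i v) }

/-- Integer expressions. `numVars`, `numTerms` and `occurs j i` read the input formula. -/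
inductive NatExpr where
  | const (v : ℕ)
  | cell (a : ℕ) (i : NatExpr)
  | add (e₁ e₂ : NatExpr)
  | sub (e₁ e₂ : NatExpr)
  | numVars
  | numTerms
  | occurs (j i : NatExpr)

/-- Real expressions. `cost i` and `prob i` read the input vectors. -/
inductive RealExpr where
  | const (v : ℕ)
  | cell (a : ℕ) (i : NatExpr)
  | add (e₁ e₂ : RealExpr)
  | sub (e₁ e₂ : RealExpr)
  | cost (i : NatExpr)
  | prob (i : NatExpr)

/-- Conditions. -/
inductive Cond where
  | natLE (e₁ e₂ : NatExpr)
  | realLE (e₁ e₂ : RealExpr)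
  | not (b : Cond)
  | and (b₁ b₂ : Cond)

/-- Programs. `test a i v` tests the variable whose index is the value of `v` and stores the outcome,
`0` or `1`, in entry `i` of the integer array `a`. -/
inductive Program where
  | skip
  | setNat (a : ℕ) (i : NatExpr) (e : NatExpr)
  | setReal (a : ℕ) (i : NatExpr) (e : RealExpr)
  | test (a : ℕ) (i : NatExpr) (v : NatExpr)
  | seq (P Q : Program)
  | cond (b : Cond) (P Q : Program)
  | loop (b : Cond) (P : Program)

/-- The value of an integer expression. Subtraction is truncated; `occurs j i` is `1` if `x_i` occurs
in term `j` (counted from `0`) and otherwise `0`, also for indices out of range. -/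
def NatExpr.eval {n : ℕ} (I : Instance n) (s : Memory) : NatExpr → ℕ
  | const v => v
  | cell a i => s.nat a (i.eval I s)
  | add e₁ e₂ => e₁.eval I s + e₂.eval I s
  | sub e₁ e₂ => e₁.eval I s - e₂.eval I s
  | numVars => n
  | numTerms => I.formula.numTerms
  | occurs j i =>
      if hj : j.eval I s < I.formula.numTerms then
        if hi : i.eval I s < n then
          if (⟨i.eval I s, hi⟩ : Fin n) ∈ I.formula.term ⟨j.eval I s, hj⟩ then 1 else 0
        else 0
      else 0

/-- The value of a real expression; `0` for an entry of an input vector that is out of range. -/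
def RealExpr.eval {n : ℕ} (I : Instance n) (s : Memory) : RealExpr → ℝ
  | const v => (v : ℝ)
  | cell a i => s.real a (i.eval I s)
  | add e₁ e₂ => e₁.eval I s + e₂.eval I s
  | sub e₁ e₂ => e₁.eval I s - e₂.eval I s
  | cost i => if hi : i.eval I s < n then I.cost ⟨i.eval I s, hi⟩ else 0
  | prob i => if hi : i.eval I s < n then I.prob ⟨i.eval I s, hi⟩ else 0

def Cond.Holds {n : ℕ} (I : Instance n) (s : Memory) : Cond → Prop
  | natLE e₁ e₂ => e₁.eval I s ≤ e₂.eval I s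
  | realLE e₁ e₂ => e₁.eval I s ≤ e₂.eval I s
  | not b => ¬ b.Holds I s
  | and b₁ b₂ => b₁.Holds I s ∧ b₂.Holds I s

/-- `Exec I x P s s' t l`: on the instance `I` and the hidden assignment `x`, the program `P` started
in memory `s` halts in memory `s'` after `t` steps, and `l` is the sequence of the tests that it
performs, in this order. One step is one assignment, test, or evaluation of a condition. Only `test`
depends on `x`; a program that tests a nonexistent variable does not halt. -/
inductive Exec {n : ℕ} (I : Instance n) (x : Fin n → Bool) :
    Program → Memory → Memory → ℕ → List (Fin n) → Prop where
  | skip (s : Memory) : Exec I x .skip s s 1 []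
  | setNat (s : Memory) (a : ℕ) (i e : NatExpr) :
      Exec I x (.setNat a i e) s (s.setNat a (i.eval I s) (e.eval I s)) 1 []
  | setReal (s : Memory) (a : ℕ) (i : NatExpr) (e : RealExpr) :
      Exec I x (.setReal a i e) s (s.setReal a (i.eval I s) (e.eval I s)) 1 []
  | test (s : Memory) (a : ℕ) (i v : NatExpr) (h : v.eval I s < n) :
      Exec I x (.test a i v) s
        (s.setNat a (i.eval I s) (x ⟨v.eval I s, h⟩).toNat) 1 [⟨v.eval I s, h⟩]
  | seq {P Q : Program} {s s₁ s₂ : Memory} {t₁ t₂ : ℕ} {l₁ l₂ : List (Fin n)} :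
      Exec I x P s s₁ t₁ l₁ → Exec I x Q s₁ s₂ t₂ l₂ →
      Exec I x (.seq P Q) s s₂ (t₁ + t₂) (l₁ ++ l₂)
  | cond_true {b : Cond} {P Q : Program} {s s' : Memory} {t : ℕ} {l : List (Fin n)} :
      b.Holds I s → Exec I x P s s' t l → Exec I x (.cond b P Q) s s' (t + 1) l
  | cond_false {b : Cond} {P Q : Program} {s s' : Memory} {t : ℕ} {l : List (Fin n)} :
      ¬ b.Holds I s → Exec I x Q s s' t l → Exec I x (.cond b P Q) s s' (t + 1) l
  | loop_done {b : Cond} {P : Program} {s : Memory} :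
      ¬ b.Holds I s → Exec I x (.loop b P) s s 1 []
  | loop_step {b : Cond} {P : Program} {s s₁ s₂ : Memory} {t₁ t₂ : ℕ} {l₁ l₂ : List (Fin n)} :
      b.Holds I s → Exec I x P s s₁ t₁ l₁ → Exec I x (.loop b P) s₁ s₂ t₂ l₂ →
      Exec I x (.loop b P) s s₂ (t₁ + t₂ + 1) (l₁ ++ l₂)

/-- Execution is deterministic. -/
theorem Exec.deterministic {n : ℕ} {I : Instance n} {x : Fin n → Bool} {P : Program}
    {s s₁ s₂ : Memory} {t₁ t₂ : ℕ} {l₁ l₂ : List (Fin n)}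
    (h₁ : Exec I x P s s₁ t₁ l₁) (h₂ : Exec I x P s s₂ t₂ l₂) :
    s₁ = s₂ ∧ t₁ = t₂ ∧ l₁ = l₂ := by
  induction h₁ generalizing s₂ t₂ l₂ with
  | skip | setNat | setReal | test => cases h₂; exact ⟨rfl, rfl, rfl⟩
  | seq _ _ ih₁ ih₂ =>
    cases h₂ with
    | seq a b =>
      obtain ⟨rfl, rfl, rfl⟩ := ih₁ a
      obtain ⟨rfl, rfl, rfl⟩ := ih₂ b
      exact ⟨rfl, rfl, rfl⟩
  | cond_true hb _ ih =>
    cases h₂ with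
    | cond_true _ a => obtain ⟨rfl, rfl, rfl⟩ := ih a; exact ⟨rfl, rfl, rfl⟩
    | cond_false hb' _ => exact absurd hb hb'
  | cond_false hb _ ih =>
    cases h₂ with
    | cond_true hb' _ => exact absurd hb' hb
    | cond_false _ a => obtain ⟨rfl, rfl, rfl⟩ := ih a; exact ⟨rfl, rfl, rfl⟩
  | loop_done hb =>
    cases h₂ with
    | loop_done _ => exact ⟨rfl, rfl, rfl⟩
    | loop_step hb' _ _ => exact absurd hb' hb
  | loop_step hb _ _ ih₁ ih₂ =>
    cases h₂ with
    | loop_done hb' => exact absurd hb hb'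
    | loop_step _ a b =>
      obtain ⟨rfl, rfl, rfl⟩ := ih₁ a
      obtain ⟨rfl, rfl, rfl⟩ := ih₂ b
      exact ⟨rfl, rfl, rfl⟩

/-- Started with empty memory, the program halts after `t` steps having performed the tests `l`, and
outputs the truth value `v` (as `0` or `1`, in entry `0` of the integer array `0`). -/
def Program.Outputs {n : ℕ} (P : Program) (I : Instance n) (x : Fin n → Bool)
    (v : Bool) (t : ℕ) (l : List (Fin n)) : Prop :=
  ∃ s : Memory, Exec I x P Memory.initial s t l ∧ s.nat 0 0 = v.toNat

/-- The cost of a sequence of tests. A test that is repeated is paid for again. -/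
def testsCost {n : ℕ} (c : Fin n → ℝ) (l : List (Fin n)) : ℝ := (l.map c).sum

end SBFE

namespace SBFE

/-! ### Expectations over the product distribution -/

/-! The algorithm is greedy. As long as some term has no variable known to be false (a live term),
it picks a live term whose untested variables are cheapest in total and tests all of them. It
answers 1 as soon as the picked term is satisfied, and 0 when no live term is left.

Two facts give the approximation ratio. The pick depends only on outcomes already seen, so the
untested variables of the picked term are independent of the history. They are all true with
probability at least `ρ ^ k`, and then the round succeeds. Hence the expected cost of each round is
at most `1 / ρ ^ k` times its expected contribution to the cost of the successful round; summing
over rounds gives `rho_pow_mul_expectation_greedyTests_le`.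

On the other hand, a certificate contained in `x` with `f x = 1` sets all variables of some
satisfied term to true, since by monotonicity its free variables may be filled with 0. A satisfied
term is always live, so the picked term costs no more than the certificate. This is
`successCost_le_certificateCost`; if `f x = 0`, no round succeeds and there is nothing to compare.
Together the two facts give the ratio `1 / ρ ^ k`; the factor 4 of the theorem is slack.

A failed round kills the picked term, so `m + 1` rounds suffice. The rest of the file implements a
round by scanning loops and verifies result, running time and exact test sequence
(`runs_greedyRound`, `runs_greedyProgram`). -/

theorem productProb_nonneg {n : ℕ} (I : Instance n) (x : Fin n → Bool) :
    0 ≤ productProb I.prob x := by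
  refine Finset.prod_nonneg fun i _ => ?_
  have := I.prob_pos i
  have := I.prob_lt_one i
  split_ifs <;> linarith

theorem productProb_update {n : ℕ} (p : Fin n → ℝ) (x : Fin n → Bool) (i : Fin n) (b : Bool) :
    productProb p (Function.update x i b) =
      (if b then p i else 1 - p i) *
        ∏ j ∈ Finset.univ.erase i, if x j then p j else 1 - p j := by
  rw [productProb, ← Finset.mul_prod_erase _ _ (Finset.mem_univ i), Function.update_self]
  congr 1
  refine Finset.prod_congr rfl fun j hj => ?_
  rw [Function.update_of_ne (Finset.ne_of_mem_erase hj)]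

theorem expectation_mono {n : ℕ} (I : Instance n) {g h : (Fin n → Bool) → ℝ}
    (hgh : ∀ x, g x ≤ h x) : expectation I.prob g ≤ expectation I.prob h :=
  Finset.sum_le_sum fun x _ => mul_le_mul_of_nonneg_left (hgh x) (productProb_nonneg I x)

theorem expectation_nonneg {n : ℕ} (I : Instance n) {g : (Fin n → Bool) → ℝ}
    (hg : ∀ x, 0 ≤ g x) : 0 ≤ expectation I.prob g :=
  Finset.sum_nonneg fun x _ => mul_nonneg (productProb_nonneg I x) (hg x)

theorem expectation_add {n : ℕ} (p : Fin n → ℝ) (g h : (Fin n → Bool) → ℝ) :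
    expectation p (fun x => g x + h x) = expectation p g + expectation p h := by
  simp only [expectation, mul_add, Finset.sum_add_distrib]

theorem expectation_mul_const {n : ℕ} (p : Fin n → ℝ) (g : (Fin n → Bool) → ℝ) (a : ℝ) :
    expectation p (fun x => g x * a) = expectation p g * a := by
  simp only [expectation, Finset.sum_mul, mul_assoc]

theorem expectation_sum {n : ℕ} {ι : Type*} (p : Fin n → ℝ) (s : Finset ι)
    (g : ι → (Fin n → Bool) → ℝ) :
    expectation p (fun x => ∑ b ∈ s, g b x) = ∑ b ∈ s, expectation p (g b) := by
  simp only [expectation, Finset.mul_sum]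
  exact Finset.sum_comm

/-- The event `x i = true` is independent of a function that ignores coordinate `i`. -/
theorem expectation_ite_coord {n : ℕ} (p : Fin n → ℝ) (i : Fin n) (g : (Fin n → Bool) → ℝ)
    (hg : ∀ x b, g (Function.update x i b) = g x) :
    expectation p (fun x => if x i = true then g x else 0) = p i * expectation p g := by
  have hinv : Function.Involutive fun x : Fin n → Bool => Function.update x i (!x i) := by
    intro x; simp
  have hsplit : expectation p g = expectation p (fun x => if x i = true then g x else 0) +
      expectation p (fun x => if x i = true then 0 else g x) := by
    rw [← expectation_add]
    congr 1; funext x; split_ifs <;> simp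
  -- Flipping coordinate `i` is a bijection between the two halves of the cube. It preserves `g` and
  -- changes the weight in the ratio `p i : 1 - p i`.
  have hflip : (1 - p i) * expectation p (fun x => if x i = true then g x else 0) =
      p i * expectation p (fun x => if x i = true then 0 else g x) := by
    unfold expectation
    rw [← Equiv.sum_comp hinv.toPerm, Finset.mul_sum, Finset.mul_sum]
    refine Finset.sum_congr rfl fun x _ => ?_
    have h1 := productProb_update p x i (!x i)
    have h2 := productProb_update p x i (x i)
    rw [Function.update_eq_self] at h2
    simp only [Function.Involutive.coe_toPerm, Function.update_self, hg]
    rw [h1, h2]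
    cases x i <;> simp
    ring
  rw [hsplit]
  linarith

/-- Used with `K` the tested variables, `g` a function of the history and `S` the untested part of
the picked term: this is the success probability of a round. The coordinates of `S` are split off
one at a time. -/
theorem expectation_ite_forall {n : ℕ} (p : Fin n → ℝ) (g : (Fin n → Bool) → ℝ)
    (K S : Finset (Fin n)) (hg : DependsOn g (K : Set (Fin n))) (hS : Disjoint S K) :
    expectation p (fun x => if ∀ i ∈ S, x i = true then g x else 0) =
      (∏ i ∈ S, p i) * expectation p g := by
  induction S using Finset.induction_on with
  | empty => simp
  | insert i S hi ih =>
    rw [Finset.disjoint_insert_left] at hS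
    rw [Finset.prod_insert hi, mul_assoc, ← ih hS.2, ← expectation_ite_coord]
    · congr 1; funext x
      simp only [Finset.forall_mem_insert, ite_and]
    · intro x b
      have h1 : g (Function.update x i b) = g x := by
        refine hg fun j hj => Function.update_of_ne ?_ _ _
        rintro rfl; exact hS.1 (Finset.mem_coe.1 hj)
      have h2 : (∀ j ∈ S, Function.update x i b j = true) ↔ ∀ j ∈ S, x j = true := by
        refine forall₂_congr fun j hj => ?_
        rw [Function.update_of_ne]
        rintro rfl; exact hi hj
      simp only [h1, h2]

theorem Instance.rho_nonneg {n : ℕ} (I : Instance n) : 0 ≤ I.rho :=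
  Real.iInf_nonneg fun i => le_min (I.prob_pos i).le (sub_nonneg.2 (I.prob_lt_one i).le)

theorem Instance.rho_le_prob {n : ℕ} (I : Instance n) (i : Fin n) : I.rho ≤ I.prob i :=
  (ciInf_le (Set.finite_range _).bddBelow i).trans (min_le_left _ _)

/-- For `n = 0` the infimum is over the empty family and equals 0, so this case is treated
separately later. -/
theorem Instance.rho_pos {n : ℕ} (I : Instance n) (hn : 0 < n) : 0 < I.rho := by
  have : Nonempty (Fin n) := ⟨⟨0, hn⟩⟩
  obtain ⟨i, hi⟩ := exists_eq_ciInf_of_finite (f := fun i => min (I.prob i) (1 - I.prob i))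
  rw [Instance.rho, ← hi]
  exact lt_min (I.prob_pos i) (sub_pos.2 (I.prob_lt_one i))

/-! ### The greedy strategy -/

/-- The `j`-th term, indexed by natural numbers. -/
def Instance.termAt {n : ℕ} (I : Instance n) (j : ℕ) : Finset (Fin n) :=
  if h : j < I.formula.numTerms then I.formula.term ⟨j, h⟩ else ∅

/-- No variable of term `j` that was tested, that is, lies in `K`, is false. -/
def Live {n : ℕ} (I : Instance n) (x : Fin n → Bool) (K : Finset (Fin n)) (j : ℕ) : Prop :=
  ∀ i ∈ I.termAt j, i ∈ K → x i = true

/-- The cost of testing the remaining variables of term `j`. -/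
def remCost {n : ℕ} (I : Instance n) (K : Finset (Fin n)) (j : ℕ) : ℝ :=
  ∑ i ∈ I.termAt j \ K, I.cost i

open Classical in
/-- One more than the first index of a cheapest live term among the first `J` terms, or `0` if none
of them is live. -/
noncomputable def best {n : ℕ} (I : Instance n) (x : Fin n → Bool) (K : Finset (Fin n)) : ℕ → ℕ
  | 0 => 0
  | J + 1 =>
    if Live I x K J ∧ (best I x K J = 0 ∨ remCost I K J < remCost I K (best I x K J - 1))
    then J + 1 else best I x K J

/-- The remaining variables of term `j`, in increasing order. -/
def remVars {n : ℕ} (I : Instance n) (K : Finset (Fin n)) (j : ℕ) : List (Fin n) :=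
  (List.finRange n).filter fun i => i ∈ I.termAt j \ K

/-- The tests that the greedy strategy performs in `r` rounds, after testing `K`. -/
noncomputable def greedyTests {n : ℕ} (I : Instance n) (x : Fin n → Bool) :
    ℕ → Finset (Fin n) → List (Fin n)
  | 0, _ => []
  | r + 1, K =>
    if best I x K I.formula.numTerms = 0 then [] else
      remVars I K (best I x K I.formula.numTerms - 1) ++
        if ∀ i ∈ I.termAt (best I x K I.formula.numTerms - 1), x i = true then [] else
          greedyTests I x r (K ∪ I.termAt (best I x K I.formula.numTerms - 1))

/-- The cost of the round in which the greedy strategy finds a satisfied term, `0` if there is no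
such round among the next `r`. -/
noncomputable def successCost {n : ℕ} (I : Instance n) (x : Fin n → Bool) :
    ℕ → Finset (Fin n) → ℝ
  | 0, _ => 0
  | r + 1, K =>
    if best I x K I.formula.numTerms = 0 then 0 else
      if ∀ i ∈ I.termAt (best I x K I.formula.numTerms - 1), x i = true then
        remCost I K (best I x K I.formula.numTerms - 1) else
      successCost I x r (K ∪ I.termAt (best I x K I.formula.numTerms - 1))

theorem remCost_nonneg {n : ℕ} (I : Instance n) (K : Finset (Fin n)) (j : ℕ) :
    0 ≤ remCost I K j :=
  Finset.sum_nonneg fun i _ => I.cost_nonneg i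

theorem eval_eq_true_iff {n : ℕ} (I : Instance n) (x : Fin n → Bool) :
    I.formula.eval x = true ↔
      ∃ j < I.formula.numTerms, ∀ i ∈ I.termAt j, x i = true := by
  rw [MonotoneDNF.eval, decide_eq_true_iff]
  constructor
  · rintro ⟨j, hj⟩
    refine ⟨j, j.2, ?_⟩
    rwa [Instance.termAt, dif_pos j.2]
  · rintro ⟨j, hj, h⟩
    rw [Instance.termAt, dif_pos hj] at h
    exact ⟨_, h⟩

theorem best_le {n : ℕ} (I : Instance n) (x : Fin n → Bool) (K : Finset (Fin n)) (J : ℕ) :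
    best I x K J ≤ J := by
  induction J with
  | zero => simp [best]
  | succ J ih => rw [best]; split_ifs <;> omega

theorem best_eq_zero {n : ℕ} {I : Instance n} {x : Fin n → Bool} {K : Finset (Fin n)} {J : ℕ}
    (h : best I x K J = 0) : ∀ j < J, ¬ Live I x K j := by
  induction J with
  | zero => simp
  | succ J ih =>
    rw [best] at h
    split_ifs at h with h'
    intro j hj
    rcases Nat.lt_succ_iff_lt_or_eq.1 hj with hj | rfl
    · exact ih h j hj
    · exact fun hl => h' ⟨hl, Or.inl h⟩

theorem best_spec {n : ℕ} {I : Instance n} {x : Fin n → Bool} {K : Finset (Fin n)} {J : ℕ}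
    (h : best I x K J ≠ 0) : Live I x K (best I x K J - 1) ∧
      ∀ j < J, Live I x K j → remCost I K (best I x K J - 1) ≤ remCost I K j := by
  induction J with
  | zero => simp [best] at h
  | succ J ih =>
    rw [best] at h ⊢
    split_ifs at h ⊢ with h'
    · refine ⟨h'.1, fun j hj hl => ?_⟩
      rw [Nat.add_sub_cancel]
      rcases Nat.lt_succ_iff_lt_or_eq.1 hj with hj | rfl
      · rcases h'.2 with h0 | h1
        · exact absurd hl (best_eq_zero h0 j hj)
        · refine h1.le.trans ((ih ?_).2 j hj hl)
          intro h0
          exact best_eq_zero h0 j hj hl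
      · exact le_rfl
    · refine ⟨(ih h).1, fun j hj hl => ?_⟩
      rcases Nat.lt_succ_iff_lt_or_eq.1 hj with hj | rfl
      · exact (ih h).2 j hj hl
      · exact not_lt.1 fun hlt => h' ⟨hl, Or.inr hlt⟩

/-- This adaptivity property is what makes the outcomes of a round independent of the choice of its
term. -/
theorem dependsOn_best {n : ℕ} (I : Instance n) (K : Finset (Fin n)) (J : ℕ) :
    DependsOn (fun x => best I x K J) (K : Set (Fin n)) := by
  intro x y hxy
  have hlive : ∀ j, Live I x K j ↔ Live I y K j := fun j =>
    forall₃_congr fun i _ hK => by rw [hxy i hK]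
  induction J with
  | zero => rfl
  | succ J ih =>
    simp only [best]
    simp only at ih
    rw [ih, hlive]

theorem testsCost_remVars {n : ℕ} (I : Instance n) (K : Finset (Fin n)) (j : ℕ) :
    testsCost I.cost (remVars I K j) = remCost I K j := by
  have hnd : (remVars I K j).Nodup := (List.nodup_finRange n).filter _
  have hfin : (remVars I K j).toFinset = I.termAt j \ K := by
    ext i; simp [remVars]
  rw [testsCost, remCost, ← hfin, List.sum_toFinset _ hnd]

/-! ### The greedy strategy is good on average -/

theorem rho_pow_le_prod {n : ℕ} (I : Instance n) (S : Finset (Fin n)) {k : ℕ} (hS : S.card ≤ k)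
    (hn : 0 < n) : I.rho ^ k ≤ ∏ i ∈ S, I.prob i := by
  have h1 : I.rho ≤ 1 := (I.rho_le_prob ⟨0, hn⟩).trans (I.prob_lt_one _).le
  calc I.rho ^ k ≤ I.rho ^ S.card := pow_le_pow_of_le_one I.rho_nonneg h1 hS
    _ = ∏ _i ∈ S, I.rho := by simp
    _ ≤ _ := Finset.prod_le_prod (fun _ _ => I.rho_nonneg) fun i _ => I.rho_le_prob i

theorem card_termAt_le {n : ℕ} (I : Instance n) {k : ℕ} (hk : I.formula.IsKDNF k) (j : ℕ) :
    (I.termAt j).card ≤ k := by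
  unfold Instance.termAt
  split_ifs
  · exact hk _
  · simp

/-- In expectation, the cost of the tests is at most `1 / ρ ^ k` times that of the successful
round, also when weighted with a function of the outcomes of the earlier tests. -/
theorem rho_pow_mul_expectation_greedyTests_le {n : ℕ} (I : Instance n) (hn : 0 < n) {k : ℕ}
    (hk : I.formula.IsKDNF k) (r : ℕ) (K : Finset (Fin n)) (h : (Fin n → Bool) → ℝ)
    (h_nonneg : ∀ x, 0 ≤ h x) (hK : DependsOn h (K : Set (Fin n))) :
    expectation I.prob (fun x => h x * testsCost I.cost (greedyTests I x r K)) * I.rho ^ k ≤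
      expectation I.prob (fun x => h x * successCost I x r K) := by
  induction r generalizing K h with
  | zero => simp [greedyTests, successCost, testsCost, expectation]
  | succ r ih =>
    set m := I.formula.numTerms with hm
    -- Split according to the picked term: on the event `best = b` the term is fixed, and `w b` is
    -- still a function of the outcomes in `K`. It therefore suffices to compare the two sides for
    -- each `b`.
    let w : ℕ → (Fin n → Bool) → ℝ := fun b x => if best I x K m = b then h x else 0
    have hw : ∀ b x, 0 ≤ w b x := fun b x => by
      simp only [w]; split_ifs
      exacts [h_nonneg x, le_rfl]
    have hwK : ∀ b, DependsOn (w b) (K : Set (Fin n)) := fun b x y hxy => by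
      simp only [w, hK hxy, show best I x K m = best I y K m from dependsOn_best I K m hxy]
    have hdec : ∀ F : (Fin n → Bool) → ℝ, (fun x => h x * F x) =
        fun x => ∑ b ∈ Finset.range (m + 1), w b x * F x := by
      intro F; funext x
      rw [← Finset.sum_mul]
      simp only [w]
      rw [Finset.sum_ite_eq, if_pos]
      exact Finset.mem_range.2 (Nat.lt_succ_of_le (best_le I x K m))
    rw [hdec, hdec, expectation_sum, expectation_sum, Finset.sum_mul]
    refine Finset.sum_le_sum fun b _ => ?_
    rcases Nat.eq_zero_or_pos b with rfl | hb
    · have e : ∀ x, w 0 x * testsCost I.cost (greedyTests I x (r + 1) K) = 0 := by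
        intro x
        by_cases hx : best I x K m = 0
        · simp [greedyTests, ← hm, hx, testsCost]
        · simp [w, hx]
      have e' : ∀ x, w 0 x * successCost I x (r + 1) K = 0 := by
        intro x
        by_cases hx : best I x K m = 0
        · simp [successCost, ← hm, hx]
        · simp [w, hx]
      simp [e, e', expectation]
    · let T := I.termAt (b - 1)
      -- The weight of the branch on which this round fails. It depends only on `K ∪ T`, so the
      -- induction hypothesis applies to it; this is why the lemma carries a general weight.
      let u : (Fin n → Bool) → ℝ := fun x => if ∀ i ∈ T, x i = true then 0 else w b x
      have hu : ∀ x, 0 ≤ u x := fun x => by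
        simp only [u]; split_ifs
        exacts [le_rfl, hw b x]
      have huK : DependsOn u ((K ∪ T : Finset (Fin n)) : Set (Fin n)) := fun x y hxy => by
        have h1 : w b x = w b y := hwK b fun i hi => hxy i (by simp_all)
        have h2 : (∀ i ∈ T, x i = true) ↔ ∀ i ∈ T, y i = true :=
          forall₂_congr fun i hi => by rw [hxy i (by simp [hi])]
        simp only [u, h1, h2]
      have e : ∀ x, w b x * testsCost I.cost (greedyTests I x (r + 1) K) =
          w b x * remCost I K (b - 1) +
            u x * testsCost I.cost (greedyTests I x r (K ∪ T)) := by
        intro x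
        by_cases hx : best I x K m = b
        · have hb' : ¬ best I x K m = 0 := by omega
          rw [greedyTests, ← hm, if_neg hb', hx, testsCost, List.map_append, List.sum_append,
            ← testsCost, ← testsCost, testsCost_remVars]
          by_cases hs : ∀ i ∈ T, x i = true
          · have hs' : ∀ i ∈ I.termAt (b - 1), x i = true := hs
            simp only [u, if_pos hs, if_pos hs']
            simp [testsCost]
          · have hs' : ¬ ∀ i ∈ I.termAt (b - 1), x i = true := hs
            simp only [u, if_neg hs, if_neg hs']
            rw [mul_add]
        · simp [u, w, hx]
      have e' : ∀ x, w b x * successCost I x (r + 1) K =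
          (if ∀ i ∈ T \ K, x i = true then w b x else 0) * remCost I K (b - 1) +
            u x * successCost I x r (K ∪ T) := by
        intro x
        by_cases hx : best I x K m = b
        · have hb' : ¬ best I x K m = 0 := by omega
          have hl : Live I x K (b - 1) := hx ▸ (best_spec hb').1
          -- The picked term is live, so success only concerns its untested variables, which are
          -- independent of `w b`.
          have hiff : (∀ i ∈ T \ K, x i = true) ↔ ∀ i ∈ T, x i = true := by
            refine ⟨fun H i hi => ?_, fun H i hi => H i (Finset.mem_sdiff.1 hi).1⟩
            by_cases hiK : i ∈ K
            · exact hl i hi hiK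
            · exact H i (Finset.mem_sdiff.2 ⟨hi, hiK⟩)
          rw [successCost, ← hm, if_neg hb', hx]
          simp only [hiff]
          by_cases hs : ∀ i ∈ T, x i = true
          · have hs' : ∀ i ∈ I.termAt (b - 1), x i = true := hs
            simp only [u, if_pos hs, if_pos hs']
            simp
          · have hs' : ¬ ∀ i ∈ I.termAt (b - 1), x i = true := hs
            simp only [u, if_neg hs, if_neg hs']
            simp [T]
        · simp [u, w, hx]
      simp only [e, e']
      rw [expectation_add, expectation_add, expectation_mul_const, expectation_mul_const,
        expectation_ite_forall _ _ K _ (hwK b) Finset.sdiff_disjoint, add_mul]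
      refine add_le_add ?_ (ih (K ∪ T) u hu huK)
      have hcard : (T \ K).card ≤ k :=
        (Finset.card_le_card Finset.sdiff_subset).trans (card_termAt_le I hk _)
      have := mul_le_mul_of_nonneg_right (rho_pow_le_prod I (T \ K) hcard hn)
        (mul_nonneg (expectation_nonneg I (hw b)) (remCost_nonneg I K (b - 1)))
      linarith

/-! ### Comparison of the successful round with certificates -/

theorem remCost_le_certificateCost {n : ℕ} (I : Instance n) {x : Fin n → Bool}
    (hx : I.formula.eval x = true) {b : Fin n → Option Bool}
    (hb : IsCertificate I.formula.eval b) (hxb : Contains x b) :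
    ∃ j < I.formula.numTerms, (∀ i ∈ I.termAt j, x i = true) ∧
      ∀ K, remCost I K j ≤ certificateCost I.cost b := by
  have h1 : IsCertificateFor I.formula.eval true b := by
    rcases hb with h0 | h1
    · exact absurd (h0 x hxb) (by simp [hx])
    · exact h1
  -- Free variables are filled with 0, so a term satisfied by this completion has all its variables
  -- set to true by `b`.
  have h2 : I.formula.eval (fun i => (b i).getD false) = true :=
    h1 _ fun i v hv => by simp [hv]
  obtain ⟨j, hj, hT⟩ := (eval_eq_true_iff I _).1 h2
  have hsome : ∀ i ∈ I.termAt j, b i = some true := by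
    intro i hi
    have := hT i hi
    cases hbi : b i with
    | none => simp [hbi] at this
    | some v => simpa [hbi] using this
  refine ⟨j, hj, fun i hi => hxb i true (hsome i hi), fun K => ?_⟩
  calc remCost I K j ≤ ∑ i ∈ I.termAt j, if (b i).isSome then I.cost i else 0 := by
        refine (Finset.sum_le_sum_of_subset_of_nonneg Finset.sdiff_subset
          fun i _ _ => I.cost_nonneg i).trans (Finset.sum_le_sum fun i hi => ?_)
        simp [hsome i hi]
    _ ≤ _ := by
        refine Finset.sum_le_sum_of_subset_of_nonneg (Finset.subset_univ _) fun i _ _ => ?_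
        split_ifs
        exacts [I.cost_nonneg i, le_rfl]

theorem successCost_le_certificateCost {n : ℕ} (I : Instance n) {x : Fin n → Bool}
    {b : Fin n → Option Bool} (hb : IsCertificate I.formula.eval b) (hxb : Contains x b)
    (r : ℕ) (K : Finset (Fin n)) : successCost I x r K ≤ certificateCost I.cost b := by
  have h0 : 0 ≤ certificateCost I.cost b := Finset.sum_nonneg fun i _ => by
    split_ifs
    exacts [I.cost_nonneg i, le_rfl]
  induction r generalizing K with
  | zero => exact h0
  | succ r ih =>
    rw [successCost]
    split_ifs with hbest hsat
    · exact h0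
    · have hx : I.formula.eval x = true := (eval_eq_true_iff I x).2
        ⟨_, by have := best_le I x K I.formula.numTerms; omega, hsat⟩
      obtain ⟨j, hj, hT, hle⟩ := remCost_le_certificateCost I hx hb hxb
      -- The term inside the certificate is satisfied by `x`, hence live whatever `K` is, and
      -- competes with the picked term.
      exact ((best_spec hbest).2 j hj fun i hi _ => hT i hi).trans (hle K)
    · exact ih _

theorem successCost_le_minCertificateCost {n : ℕ} (I : Instance n) (x : Fin n → Bool) (r : ℕ)
    (K : Finset (Fin n)) :
    successCost I x r K ≤ minCertificateCost I.formula.eval I.cost x := by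
  refine le_csInf (Set.Nonempty.image _ ⟨fun i => some (x i), ?_, ?_⟩) ?_
  · have hc : IsCertificateFor I.formula.eval (I.formula.eval x) fun i => some (x i) :=
      fun a ha => congrArg _ (funext fun i => ha i _ rfl)
    cases h : I.formula.eval x
    · exact Or.inl (h ▸ hc)
    · exact Or.inr (h ▸ hc)
  · intro i v hv
    simpa using hv
  · rintro _ ⟨b, ⟨hb, hxb⟩, rfl⟩
    exact successCost_le_certificateCost I hb hxb r K

theorem expectation_greedyTests_le {n : ℕ} (I : Instance n) {k : ℕ} (hk : I.formula.IsKDNF k)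
    (r : ℕ) : expectation I.prob (fun x => testsCost I.cost (greedyTests I x r ∅)) ≤
      4 / I.rho ^ k * expectation I.prob (minCertificateCost I.formula.eval I.cost) := by
  -- With 0 rounds `successCost` is 0, so its upper bound is nonnegative.
  have hcert : 0 ≤ expectation I.prob (minCertificateCost I.formula.eval I.cost) :=
    expectation_nonneg I fun x => successCost_le_minCertificateCost I x 0 ∅
  rcases Nat.eq_zero_or_pos n with rfl | hn
  · have hnil : ∀ x, testsCost I.cost (greedyTests I x r ∅) = 0 := fun x => by
      have : greedyTests I x r ∅ = [] := List.eq_nil_iff_forall_not_mem.2 fun i => i.elim0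
      rw [this]; rfl
    simp only [hnil]
    refine le_trans (by simp [expectation]) (mul_nonneg ?_ hcert)
    exact div_nonneg (by norm_num) (pow_nonneg I.rho_nonneg k)
  · have hρ := pow_pos (I.rho_pos hn) k
    have h1 := rho_pow_mul_expectation_greedyTests_le I hn hk r ∅ (fun _ => 1)
      (fun _ => zero_le_one) (fun _ _ _ => rfl)
    simp only [one_mul] at h1
    have h2 := expectation_mono I fun x => successCost_le_minCertificateCost I x r ∅
    -- The bound already holds with 1 in place of 4; `hcert` absorbs the difference.
    rw [div_mul_eq_mul_div, le_div_iff₀ hρ]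
    linarith

/-! ### Total correctness of programs -/

theorem Memory.nat_setNat (s : Memory) (a i v b k : ℕ) :
    (s.setNat a i v).nat b k = if b = a ∧ k = i then v else s.nat b k := by
  simp only [Memory.setNat, Function.update_apply]
  by_cases hb : b = a
  · subst hb; simp [Function.update_apply]
  · simp [hb]

theorem Memory.real_setReal (s : Memory) (a i : ℕ) (v : ℝ) (b k : ℕ) :
    (s.setReal a i v).real b k = if b = a ∧ k = i then v else s.real b k := by
  simp only [Memory.setReal, Function.update_apply]
  by_cases hb : b = a
  · subst hb; simp [Function.update_apply]
  · simp [hb]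

theorem Memory.real_setNat (s : Memory) (a i v : ℕ) : (s.setNat a i v).real = s.real := rfl

theorem Memory.nat_setReal (s : Memory) (a i : ℕ) (v : ℝ) : (s.setReal a i v).nat = s.nat := rfl

/-- Started in `s`, the program halts after at most `T` steps, performs the tests `l`, and the
final memory satisfies `Q`. -/
def Runs {n : ℕ} (I : Instance n) (x : Fin n → Bool) (P : Program) (s : Memory) (T : ℕ)
    (l : List (Fin n)) (Q : Memory → Prop) : Prop :=
  ∃ s' t, Exec I x P s s' t l ∧ t ≤ T ∧ Q s'

/-! ### Hoare-style rules with step bound and test list -/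

section Rules

variable {n : ℕ} {I : Instance n} {x : Fin n → Bool} {P P' : Program} {s : Memory} {T T₁ T₂ : ℕ}
  {l l₁ l₂ : List (Fin n)} {Q R : Memory → Prop}

theorem Runs.mono (h : Runs I x P s T₁ l Q) (hT : T₁ ≤ T) (hQ : ∀ s', Q s' → R s') :
    Runs I x P s T l R := by
  obtain ⟨s', t, he, ht, hs⟩ := h
  exact ⟨s', t, he, ht.trans hT, hQ _ hs⟩

theorem Runs.skip (hT : 1 ≤ T) (h : Q s) : Runs I x .skip s T [] Q :=
  ⟨s, 1, .skip s, hT, h⟩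

theorem Runs.setNat {a : ℕ} {i e : NatExpr} (hT : 1 ≤ T)
    (h : Q (s.setNat a (i.eval I s) (e.eval I s))) : Runs I x (.setNat a i e) s T [] Q :=
  ⟨_, 1, .setNat s a i e, hT, h⟩

theorem Runs.setReal {a : ℕ} {i : NatExpr} {e : RealExpr} (hT : 1 ≤ T)
    (h : Q (s.setReal a (i.eval I s) (e.eval I s))) : Runs I x (.setReal a i e) s T [] Q :=
  ⟨_, 1, .setReal s a i e, hT, h⟩

theorem Runs.test {a : ℕ} {i v : NatExpr} {j : Fin n} (hT : 1 ≤ T) (hj : v.eval I s = j)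
    (h : Q (s.setNat a (i.eval I s) (x j).toNat)) : Runs I x (.test a i v) s T [j] Q := by
  have hlt : v.eval I s < n := hj ▸ j.2
  obtain rfl : j = ⟨v.eval I s, hlt⟩ := Fin.ext hj.symm
  exact ⟨_, 1, .test s a i v hlt, hT, h⟩

theorem Runs.seq (h : Runs I x P s T₁ l₁ fun s₁ => Runs I x P' s₁ T₂ l₂ Q) (hT : T₁ + T₂ ≤ T)
    (hl : l₁ ++ l₂ = l) : Runs I x (.seq P P') s T l Q := by
  obtain ⟨s₁, t₁, he₁, ht₁, s₂, t₂, he₂, ht₂, hQ⟩ := h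
  subst hl
  exact ⟨s₂, _, .seq he₁ he₂, (add_le_add ht₁ ht₂).trans hT, hQ⟩

theorem Runs.cond {b : Cond} (hT : T₁ + 1 ≤ T) (h₁ : b.Holds I s → Runs I x P s T₁ l Q)
    (h₂ : ¬ b.Holds I s → Runs I x P' s T₁ l Q) : Runs I x (.cond b P P') s T l Q := by
  by_cases hb : b.Holds I s
  · obtain ⟨s', t, he, ht, hQ⟩ := h₁ hb
    exact ⟨s', _, .cond_true hb he, (add_le_add_left ht 1).trans hT, hQ⟩
  · obtain ⟨s', t, he, ht, hQ⟩ := h₂ hb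
    exact ⟨s', _, .cond_false hb he, (add_le_add_left ht 1).trans hT, hQ⟩

theorem Runs.loop_done {b : Cond} (hT : 1 ≤ T) (hb : ¬ b.Holds I s) (hQ : Q s) :
    Runs I x (.loop b P) s T [] Q :=
  ⟨s, 1, .loop_done hb, hT, hQ⟩

theorem Runs.loop_step {b : Cond} (hb : b.Holds I s)
    (h : Runs I x P s T₁ l₁ fun s₁ => Runs I x (.loop b P) s₁ T₂ l₂ Q) (hT : T₁ + T₂ + 1 ≤ T)
    (hl : l₁ ++ l₂ = l) : Runs I x (.loop b P) s T l Q := by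
  obtain ⟨s₁, t₁, he₁, ht₁, s₂, t₂, he₂, ht₂, hQ⟩ := h
  subst hl
  exact ⟨s₂, _, .loop_step hb he₁ he₂, by omega, hQ⟩

end Rules

/-- The scalar variable that is kept in entry `0` of the integer array `a`. -/
def NatExpr.scalar (a : ℕ) : NatExpr := .cell a (.const 0)

/-- Run `P` for the values `0`, `1`, … of the scalar variable `a` below `N`. -/
def Program.forBelow (a : ℕ) (N : NatExpr) (P : Program) : Program :=
  .seq (.setNat a (.const 0) (.const 0))
    (.loop (.natLE (.add (.scalar a) (.const 1)) N)
      (.seq P (.setNat a (.const 0) (.add (.scalar a) (.const 1)))))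

/-- Each iteration pays `B` for the body, 1 for the loop condition and 1 for the increment; the
final 2 is the initialization and the failing condition. The invariant is required after the
increment, and the body has to leave the counter unchanged. -/
theorem Runs.forBelow {n : ℕ} {I : Instance n} {x : Fin n → Bool} {P : Program} {s : Memory}
    {a N B : ℕ} {e : NatExpr} (tests : ℕ → List (Fin n)) (Inv : ℕ → Memory → Prop)
    (he : ∀ s, e.eval I s = N) (h_init : Inv 0 (s.setNat a 0 0))
    (h_ctr : ∀ i s, Inv i s → s.nat a 0 = i)
    (h_body : ∀ i < N, ∀ s, Inv i s → Runs I x P s B (tests i) fun s' =>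
      s'.nat a 0 = i ∧ Inv (i + 1) (s'.setNat a 0 (i + 1))) :
    Runs I x (.forBelow a e P) s (N * (B + 2) + 2) ((List.range N).flatMap tests) (Inv N) := by
  -- Induction on the number `k` of iterations still to come.
  have key : ∀ k i, i + k = N → ∀ s, Inv i s →
      Runs I x (.loop (.natLE (.add (.scalar a) (.const 1)) e)
        (.seq P (.setNat a (.const 0) (.add (.scalar a) (.const 1))))) s (k * (B + 2) + 1)
        ((List.range' i k).flatMap tests) (Inv N) := by
    intro k
    induction k with
    | zero =>
      intro i hi s hs
      obtain rfl : i = N := hi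
      refine Runs.loop_done (by omega) ?_ hs
      simp [Cond.Holds, NatExpr.eval, NatExpr.scalar, he, h_ctr i s hs]
    | succ k ih =>
      intro i hi s hs
      have hb := h_body i (by omega) s hs
      refine Runs.loop_step (T₁ := B + 1) (T₂ := k * (B + 2) + 1) (l₁ := tests i)
        (l₂ := (List.range' (i + 1) k).flatMap tests) ?_ ?_ (by ring_nf; omega) ?_
      · simp [Cond.Holds, NatExpr.eval, NatExpr.scalar, he, h_ctr i s hs]
        omega
      · refine Runs.seq (T₂ := 1) (l₂ := []) (hb.mono le_rfl fun s' hs' => ?_) le_rfl (by simp)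
        refine Runs.setNat le_rfl ?_
        simp only [NatExpr.eval, NatExpr.scalar, hs'.1]
        exact ih (i + 1) (by omega) _ hs'.2
      · rw [List.range'_succ, List.flatMap_cons]
  refine Runs.seq (T₁ := 1) (T₂ := N * (B + 2) + 1) (l₁ := []) (Runs.setNat le_rfl ?_)
    (by omega) rfl
  rw [List.range_eq_range']
  exact key N 0 (zero_add N) _ h_init

/-! ### The program

Integer arrays: `0` holds the output and a flag for termination, `1` tells which variables were
tested, `2` holds the outcomes. Scalar variables: `3` and `4` run over the variables and the terms,
`5` tells if the current term is live, `6` is `best`, `7` tells if the chosen term is satisfied; the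
real scalars `0` and `1` are the remaining costs of the current and of the best term. -/

/-- Update liveness and remaining cost of term `4` by its variable `3`. -/
def scanVariable : Program :=
  .cond (.natLE (.const 1) (.occurs (.scalar 4) (.scalar 3)))
    (.cond (.natLE (.const 1) (.cell 1 (.scalar 3)))
      (.cond (.natLE (.const 1) (.cell 2 (.scalar 3)))
        .skip
        (.setNat 5 (.const 0) (.const 0)))
      (.setReal 0 (.const 0) (.add (.cell 0 (.const 0)) (.cost (.scalar 3)))))
    .skip

/-- Update `best` by term `4`. -/
def scanTerm : Program :=
  .seq (.setNat 5 (.const 0) (.const 1))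
    (.seq (.setReal 0 (.const 0) (.const 0))
      (.seq (.forBelow 3 .numVars scanVariable)
        (.cond (.and (.natLE (.const 1) (.scalar 5))
            (.not (.and (.natLE (.const 1) (.scalar 6))
              (.realLE (.cell 1 (.const 0)) (.cell 0 (.const 0))))))
          (.seq (.setNat 6 (.const 0) (.add (.scalar 4) (.const 1)))
            (.setReal 1 (.const 0) (.cell 0 (.const 0))))
          .skip)))

/-- Test variable `3` if it occurs in the chosen term and was not tested. -/
def probeVariable : Program :=
  .cond (.natLE (.const 1) (.occurs (.sub (.scalar 6) (.const 1)) (.scalar 3)))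
    (.seq
      (.cond (.natLE (.const 1) (.cell 1 (.scalar 3)))
        .skip
        (.seq (.test 2 (.scalar 3) (.scalar 3)) (.setNat 1 (.scalar 3) (.const 1))))
      (.cond (.natLE (.const 1) (.cell 2 (.scalar 3)))
        .skip
        (.setNat 7 (.const 0) (.const 0))))
    .skip

/-- Choose a term and test its remaining variables. -/
def greedyRound : Program :=
  .seq (.setNat 6 (.const 0) (.const 0))
    (.seq (.forBelow 4 .numTerms scanTerm)
      (.cond (.natLE (.const 1) (.scalar 6))
        (.seq (.setNat 7 (.const 0) (.const 1))
          (.seq (.forBelow 3 .numVars probeVariable)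
            (.cond (.natLE (.const 1) (.scalar 7))
              (.seq (.setNat 0 (.const 0) (.const 1)) (.setNat 0 (.const 1) (.const 1)))
              .skip)))
        (.setNat 0 (.const 1) (.const 1))))

def greedyProgram : Program :=
  .loop (.natLE (.cell 0 (.const 1)) (.const 0)) greedyRound

/-! ### Correctness of the program -/

/-- The memory describes the outcomes of the tests of the variables in `K`. -/
def Records {n : ℕ} (x : Fin n → Bool) (K : Finset (Fin n)) (s : Memory) : Prop :=
  ∀ i : Fin n, s.nat 1 i = (if i ∈ K then 1 else 0) ∧ (i ∈ K → s.nat 2 i = (x i).toNat)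

/-- No bound on the term index is needed: `termAt` is empty out of range, where `occurs` is 0. -/
theorem eval_occurs {n : ℕ} (I : Instance n) (s : Memory) (e₁ e₂ : NatExpr) (i : Fin n)
    (hi : e₂.eval I s = i) :
    (NatExpr.occurs e₁ e₂).eval I s = if i ∈ I.termAt (e₁.eval I s) then 1 else 0 := by
  have hlt : e₂.eval I s < n := hi ▸ i.2
  obtain rfl : i = ⟨e₂.eval I s, hlt⟩ := Fin.ext hi.symm
  simp only [NatExpr.eval, Instance.termAt, dif_pos hlt]
  by_cases hj : e₁.eval I s < I.formula.numTerms <;> simp [hj]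

/-- The first `i` variables. -/
def varsBelow (n i : ℕ) : Finset (Fin n) := Finset.univ.filter fun j => j.val < i

theorem mem_varsBelow {n i : ℕ} {j : Fin n} : j ∈ varsBelow n i ↔ j.val < i := by
  simp [varsBelow]

theorem varsBelow_zero (n : ℕ) : varsBelow n 0 = ∅ := by
  ext; simp [mem_varsBelow]

theorem varsBelow_self (n : ℕ) : varsBelow n n = Finset.univ := by
  ext j; simp [mem_varsBelow]

theorem varsBelow_succ {n : ℕ} (i : Fin n) :
    varsBelow n (i + 1) = insert i (varsBelow n i) := by
  ext j
  simp only [mem_varsBelow, Finset.mem_insert, Fin.ext_iff]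
  omega

theorem self_notMem_varsBelow {n : ℕ} (i : Fin n) : i ∉ varsBelow n i := by
  simp [mem_varsBelow]

open Classical in
/-- The state of the scan of term `j` before its variable `i`. -/
def ScanVariableInv {n : ℕ} (I : Instance n) (x : Fin n → Bool) (K : Finset (Fin n)) (j : ℕ)
    (s₀ : Memory) (i : ℕ) (s : Memory) : Prop :=
  s.nat 3 0 = i ∧ (∀ a, a ≠ 3 → a ≠ 5 → ∀ k, s.nat a k = s₀.nat a k) ∧
  (∀ k, s.real 1 k = s₀.real 1 k) ∧
  s.nat 5 0 = (if ∀ v ∈ varsBelow n i, v ∈ I.termAt j → v ∈ K → x v = true then 1 else 0) ∧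
  s.real 0 0 = ∑ v ∈ varsBelow n i, if v ∈ I.termAt j \ K then I.cost v else 0

theorem runs_scanVariable {n : ℕ} {I : Instance n} {x : Fin n → Bool} {K : Finset (Fin n)}
    {j : ℕ} {s₀ s : Memory} (hK : Records x K s₀) (hj : s₀.nat 4 0 = j) (i : Fin n)
    (h : ScanVariableInv I x K j s₀ i s) :
    Runs I x scanVariable s 4 [] fun s' =>
      s'.nat 3 0 = i ∧ ScanVariableInv I x K j s₀ (i + 1) (s'.setNat 3 0 (i + 1)) := by
  obtain ⟨h3, hf, hr1, h5, hr0⟩ := h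
  have h4 : s.nat 4 0 = j := (hf 4 (by decide) (by decide) 0).trans hj
  have hocc : (NatExpr.occurs (.scalar 4) (.scalar 3)).eval I s =
      if i ∈ I.termAt j then 1 else 0 := by
    rw [eval_occurs I s _ _ i (by simp [NatExpr.eval, NatExpr.scalar, h3])]
    simp [NatExpr.eval, NatExpr.scalar, h4]
  have h1 : s.nat 1 i = if i ∈ K then 1 else 0 :=
    (hf 1 (by decide) (by decide) i).trans (hK i).1
  have h2 : i ∈ K → s.nat 2 i = (x i).toNat := fun hi =>
    (hf 2 (by decide) (by decide) i).trans ((hK i).2 hi)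
  simp only [ScanVariableInv, varsBelow_succ, Finset.forall_mem_insert,
    Finset.sum_insert (self_notMem_varsBelow i)]
  refine Runs.cond (T₁ := 3) le_rfl (fun hT => ?_) fun hT => ?_
  · have hT : i ∈ I.termAt j := by
      rw [Cond.Holds, hocc] at hT
      by_contra hc
      simp [NatExpr.eval, hc] at hT
    refine Runs.cond (T₁ := 2) le_rfl (fun hk => ?_) fun hk => ?_
    · have hk : i ∈ K := by
        by_contra hc
        simp [Cond.Holds, NatExpr.eval, NatExpr.scalar, h3, h1, hc] at hk
      refine Runs.cond (T₁ := 1) le_rfl (fun hx => ?_) fun hx => ?_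
      · have hx : x i = true := by
          by_contra hc
          rw [Bool.not_eq_true] at hc
          simp [Cond.Holds, NatExpr.eval, NatExpr.scalar, h3, h2 hk, hc] at hx
        refine Runs.skip le_rfl ⟨h3, ?_⟩
        simp +contextual [Memory.nat_setNat, Memory.real_setNat, hf, hr1, h5, hr0, hT, hk, hx]
      · have hx : x i = false := by
          by_contra hc
          rw [Bool.not_eq_false] at hc
          simp [Cond.Holds, NatExpr.eval, NatExpr.scalar, h3, h2 hk, hc] at hx
        refine Runs.setNat le_rfl ?_
        simp +contextual [NatExpr.eval, Memory.nat_setNat, Memory.real_setNat, h3, hf, hr1, hr0,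
          hT, hk, hx]
    · have hk : i ∉ K := by
        intro hc
        simp [Cond.Holds, NatExpr.eval, NatExpr.scalar, h3, h1, hc] at hk
      refine Runs.setReal (by decide) ?_
      simp +contextual [NatExpr.eval, NatExpr.scalar, RealExpr.eval, Memory.nat_setNat,
        Memory.real_setNat, Memory.nat_setReal, Memory.real_setReal, h3, hf, hr1, h5, hr0, hT, hk,
        add_comm]
  · have hT : i ∉ I.termAt j := by
      intro hc
      rw [Cond.Holds, hocc, if_pos hc] at hT
      exact hT le_rfl
    refine Runs.skip (by decide) ⟨h3, ?_⟩
    simp +contextual [Memory.nat_setNat, Memory.real_setNat, hf, hr1, h5, hr0, hT]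

open Classical in
/-- The state of the search for a cheapest live term before term `j`. -/
def ScanTermInv {n : ℕ} (I : Instance n) (x : Fin n → Bool) (K : Finset (Fin n))
    (s₀ : Memory) (j : ℕ) (s : Memory) : Prop :=
  s.nat 4 0 = j ∧ (∀ a < 3, ∀ k, s.nat a k = s₀.nat a k) ∧ s.nat 6 0 = best I x K j ∧
  (best I x K j ≠ 0 → s.real 1 0 = remCost I K (best I x K j - 1))

/-- The time is 2 initial assignments, `n * 6 + 2` for the loop over the variables, and 3 for the
final comparison and update. -/
theorem runs_scanTerm {n : ℕ} {I : Instance n} {x : Fin n → Bool} {K : Finset (Fin n)}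
    {s₀ s : Memory} (hK : Records x K s₀) (j : ℕ) (h : ScanTermInv I x K s₀ j s) :
    Runs I x scanTerm s (n * 6 + 7) [] fun s' =>
      s'.nat 4 0 = j ∧ ScanTermInv I x K s₀ (j + 1) (s'.setNat 4 0 (j + 1)) := by
  obtain ⟨h4, hf, h6, hr1⟩ := h
  refine Runs.seq (T₁ := 1) (T₂ := n * 6 + 6) (l₁ := []) (l₂ := []) (Runs.setNat le_rfl ?_)
    (by omega) rfl
  refine Runs.seq (T₁ := 1) (T₂ := n * 6 + 5) (l₁ := []) (l₂ := []) (Runs.setReal le_rfl ?_)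
    (by omega) rfl
  simp only [NatExpr.eval, RealExpr.eval, Nat.cast_zero]
  set s₁ := (s.setNat 5 0 1).setReal 0 0 0 with hs₁
  have hK₁ : Records x K s₁ := fun i => by
    simpa [hs₁, Memory.nat_setReal, Memory.nat_setNat, hf] using hK i
  have hscan := Runs.forBelow (s := s₁) (a := 3) (N := n) (e := .numVars) (P := scanVariable)
    (I := I) (x := x) (B := 4) (fun _ => [])
    (ScanVariableInv I x K j s₁) (fun _ => rfl)
    (by simp +contextual [ScanVariableInv, Memory.nat_setNat, Memory.real_setNat, varsBelow_zero,
          hs₁, Memory.nat_setReal, Memory.real_setReal])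
    (fun _ _ h => h.1)
    (fun i hi s hs => runs_scanVariable hK₁
      (by simp [hs₁, Memory.nat_setReal, Memory.nat_setNat, h4]) ⟨i, hi⟩ hs)
  rw [List.flatMap_eq_nil_iff.2 (by simp)] at hscan
  refine Runs.seq (T₂ := 3) (l₂ := []) (hscan.mono le_rfl fun s' hs' => ?_) (by omega) rfl
  obtain ⟨-, hf', hr1', h5', hr0'⟩ := hs'
  have hlive : s'.nat 5 0 = 1 ↔ Live I x K j := by
    rw [h5']; simp [varsBelow_self, Live]
  have hlive' : s'.nat 5 0 = 0 ↔ ¬ Live I x K j := by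
    rw [h5']; simp [varsBelow_self, Live]
  have hr0 : s'.real 0 0 = remCost I K j := by
    rw [hr0', varsBelow_self, Finset.sum_ite_mem, Finset.univ_inter, remCost]
  have h4' : s'.nat 4 0 = j := by
    rw [hf' 4 (by decide) (by decide)]; simp [hs₁, Memory.nat_setReal, Memory.nat_setNat, h4]
  have h6' : s'.nat 6 0 = best I x K j := by
    rw [hf' 6 (by decide) (by decide)]; simp [hs₁, Memory.nat_setReal, Memory.nat_setNat, h6]
  have hr1'' : best I x K j ≠ 0 → s'.real 1 0 = remCost I K (best I x K j - 1) := fun hb => by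
    rw [hr1', hs₁, ← hr1 hb]; simp [Memory.real_setReal, Memory.real_setNat]
  have hfr : ∀ a < 3, ∀ k, s'.nat a k = s₀.nat a k := fun a ha k => by
    rw [hf' a (by omega) (by omega), ← hf a ha]
    simp only [hs₁, Memory.nat_setReal, Memory.nat_setNat]
    rw [if_neg (by omega)]
  -- The conditions offer only `≤`, negation and conjunction, so the disjunction and the strict
  -- inequality in `best` are encoded by De Morgan. If `best` is 0, the stale content of real scalar
  -- `1` is irrelevant.
  have hcond : (Cond.and (.natLE (.const 1) (.scalar 5))
      (.not (.and (.natLE (.const 1) (.scalar 6))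
        (.realLE (.cell 1 (.const 0)) (.cell 0 (.const 0)))))).Holds I s' ↔
      Live I x K j ∧
        (best I x K j = 0 ∨ remCost I K j < remCost I K (best I x K j - 1)) := by
    simp only [Cond.Holds, NatExpr.eval, RealExpr.eval, NatExpr.scalar, h6', hr0]
    refine and_congr ?_ ?_
    · rw [← hlive, h5']; split_ifs <;> simp
    · by_cases hb : best I x K j = 0
      · simp [hb]
      · simp [hb, hr1'' hb, Nat.one_le_iff_ne_zero]
  simp only [ScanTermInv]
  refine Runs.cond (T₁ := 2) le_rfl (fun hc => ?_) fun hc => ?_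
  · rw [hcond] at hc
    have hbest : best I x K (j + 1) = j + 1 := by rw [best, if_pos hc]
    rw [hbest]
    refine Runs.seq (T₁ := 1) (T₂ := 1) (l₁ := []) (l₂ := []) (Runs.setNat le_rfl ?_) le_rfl rfl
    refine Runs.setReal le_rfl ?_
    simp only [NatExpr.eval, NatExpr.scalar, RealExpr.eval, Memory.nat_setNat, Memory.real_setNat,
      Memory.nat_setReal, Memory.real_setReal, h4', hr0]
    refine ⟨by simp, by simp, fun a ha k => ?_, by simp, by simp⟩
    rw [if_neg (by omega), if_neg (by omega)]
    exact hfr a ha k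
  · rw [hcond] at hc
    have hbest : best I x K (j + 1) = best I x K j := by rw [best, if_neg hc]
    rw [hbest]
    refine Runs.skip (by decide) ⟨h4', by simp [Memory.nat_setNat], fun a ha k => ?_, ?_, hr1''⟩
    · rw [Memory.nat_setNat, if_neg (by omega)]
      exact hfr a ha k
    · simp [Memory.nat_setNat, h6']

/-- The state before variable `i` of the chosen term `b` is tested. -/
def ProbeInv {n : ℕ} (I : Instance n) (x : Fin n → Bool) (K : Finset (Fin n)) (b : ℕ)
    (s₀ : Memory) (i : ℕ) (s : Memory) : Prop :=
  s.nat 3 0 = i ∧ s.nat 6 0 = b + 1 ∧ (∀ k, s.nat 0 k = s₀.nat 0 k) ∧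
  s.nat 7 0 = (if ∀ v ∈ varsBelow n i, v ∈ I.termAt b → x v = true then 1 else 0) ∧
  Records x (K ∪ (I.termAt b ∩ varsBelow n i)) s

theorem runs_probeVariable {n : ℕ} {I : Instance n} {x : Fin n → Bool} {K : Finset (Fin n)}
    {b : ℕ} {s₀ s : Memory} (i : Fin n) (h : ProbeInv I x K b s₀ i s) :
    Runs I x probeVariable s 6 (if i ∈ I.termAt b \ K then [i] else []) fun s' =>
      s'.nat 3 0 = i ∧ ProbeInv I x K b s₀ (i + 1) (s'.setNat 3 0 (i + 1)) := by
  obtain ⟨h3, h6, h0, h7, hK⟩ := h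
  have hocc : (NatExpr.occurs (.sub (.scalar 6) (.const 1)) (.scalar 3)).eval I s =
      if i ∈ I.termAt b then 1 else 0 := by
    rw [eval_occurs I s _ _ i (by simp [NatExpr.eval, NatExpr.scalar, h3])]
    simp [NatExpr.eval, NatExpr.scalar, h6]
  simp only [ProbeInv, varsBelow_succ, Finset.forall_mem_insert]
  refine Runs.cond (T₁ := 5) le_rfl (fun hT => ?_) fun hT => ?_
  · have hT : i ∈ I.termAt b := by
      rw [Cond.Holds, hocc] at hT
      by_contra hc
      simp [NatExpr.eval, hc] at hT
    set K' := K ∪ (I.termAt b ∩ varsBelow n i) with hK'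
    have hins : K ∪ (I.termAt b ∩ insert i (varsBelow n i)) = insert i K' := by
      rw [Finset.inter_insert_of_mem hT, Finset.union_insert]
    -- The loop has so far tested only variables below `i`, so `i` is marked as tested exactly if it
    -- was before the round; no test is repeated.
    have hiK : i ∈ K' ↔ i ∈ K := by
      simp [hK', self_notMem_varsBelow]
    rw [hins]
    refine Runs.seq (T₁ := 3) (T₂ := 2) (l₂ := []) (Q := _)
      (l₁ := if i ∈ I.termAt b \ K then [i] else [])
      (Runs.mono (Q := fun s₁ => s₁.nat 3 0 = i ∧ s₁.nat 6 0 = b + 1 ∧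
        (∀ k, s₁.nat 0 k = s₀.nat 0 k) ∧
        s₁.nat 7 0 = (if ∀ v ∈ varsBelow n i, v ∈ I.termAt b → x v = true then 1 else 0) ∧
        Records x (insert i K') s₁) ?_ le_rfl fun s₁ h₁ => ?_) le_rfl (by simp)
    · refine Runs.cond (T₁ := 2) le_rfl (fun hk => ?_) fun hk => ?_
      · have hk : i ∈ K' := by
          by_contra hc
          simp [Cond.Holds, NatExpr.eval, NatExpr.scalar, h3, (hK i).1, hc] at hk
        rw [if_neg (by simp [hiK.1 hk]), Finset.insert_eq_of_mem hk]
        exact Runs.skip (by decide) ⟨h3, h6, h0, h7, hK⟩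
      · have hk : i ∉ K' := by
          intro hc
          simp [Cond.Holds, NatExpr.eval, NatExpr.scalar, h3, (hK i).1, hc] at hk
        rw [if_pos (by simp [hT, mt hiK.2 hk])]
        refine Runs.seq (T₁ := 1) (T₂ := 1) (l₁ := [i]) (l₂ := [])
          (Runs.test le_rfl (by simp [NatExpr.eval, NatExpr.scalar, h3]) ?_) le_rfl rfl
        refine Runs.setNat le_rfl ?_
        simp only [NatExpr.eval, NatExpr.scalar, Memory.nat_setNat, h3]
        refine ⟨by simp, by simpa using h6, by simpa using h0, by simpa using h7, ?_⟩
        intro v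
        simp only [Memory.nat_setNat, Finset.mem_insert]
        by_cases hv : v = i
        · simp [hv]
        · simpa [hv, Fin.val_inj] using hK v
    · obtain ⟨h3, h6, h0, h7, hK⟩ := h₁
      have h2 : s₁.nat 2 i = (x i).toNat := (hK i).2 (Finset.mem_insert_self _ _)
      refine Runs.cond (T₁ := 1) le_rfl (fun hx => ?_) fun hx => ?_
      · have hx : x i = true := by
          by_contra hc
          rw [Bool.not_eq_true] at hc
          simp [Cond.Holds, NatExpr.eval, NatExpr.scalar, h3, h2, hc] at hx
        refine Runs.skip le_rfl ⟨h3, ?_⟩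
        refine ⟨by simp [Memory.nat_setNat], by simpa [Memory.nat_setNat] using h6,
          by simpa [Memory.nat_setNat] using h0, by simp [Memory.nat_setNat, h7, hT, hx], ?_⟩
        simpa [Records, Memory.nat_setNat] using hK
      · have hx : x i = false := by
          by_contra hc
          rw [Bool.not_eq_false] at hc
          simp [Cond.Holds, NatExpr.eval, NatExpr.scalar, h3, h2, hc] at hx
        refine Runs.setNat le_rfl ?_
        refine ⟨by simpa [Memory.nat_setNat] using h3, by simp [Memory.nat_setNat],
          by simpa [Memory.nat_setNat] using h6, by simpa [Memory.nat_setNat] using h0,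
          by simp [Memory.nat_setNat, NatExpr.eval, hT, hx], ?_⟩
        simpa [Records, Memory.nat_setNat] using hK
  · have hT : i ∉ I.termAt b := by
      intro hc
      rw [Cond.Holds, hocc, if_pos hc] at hT
      exact hT le_rfl
    rw [if_neg (by simp [hT]), Finset.inter_insert_of_notMem hT]
    refine Runs.skip (by decide) ⟨h3, by simp [Memory.nat_setNat],
      by simpa [Memory.nat_setNat] using h6, by simpa [Memory.nat_setNat] using h0,
      by simp [Memory.nat_setNat, h7, hT], ?_⟩
    simpa [Records, Memory.nat_setNat] using hK

/-- Identifies the test sequence that the probing loop produces with the list used by the greedy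
strategy. -/
theorem flatMap_range_eq_remVars {n : ℕ} (I : Instance n) (K : Finset (Fin n)) (b : ℕ) :
    (List.range n).flatMap (fun i => if h : i < n then
      if (⟨i, h⟩ : Fin n) ∈ I.termAt b \ K then [⟨i, h⟩] else [] else []) = remVars I K b := by
  rw [← List.map_coe_finRange_eq_range, List.flatMap_map, remVars]
  generalize List.finRange n = L
  induction L with
  | nil => rfl
  | cons i L ih =>
    rw [List.flatMap_cons, ih, dif_pos i.2, List.filter_cons]
    by_cases hi : i ∈ I.termAt b \ K
    · rw [if_pos hi, if_pos (by simpa using hi)]; rfl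
    · rw [if_neg hi, if_neg (by simpa using hi)]; rfl

/-- A bound on the number of steps of a round. -/
def roundTime (n m : ℕ) : ℕ := 1 + (m * (n * 6 + 9) + 2) + (1 + (1 + (n * 8 + 2) + 3))

/-- The three outcomes are: no live term (stop, output unchanged), picked term satisfied (stop with
output 1), picked term refuted (continue with more recorded outcomes). -/
theorem runs_greedyRound {n : ℕ} {I : Instance n} {x : Fin n → Bool} {K : Finset (Fin n)}
    {s : Memory} (hK : Records x K s) {B : ℕ} (hB : best I x K I.formula.numTerms = B) :
    Runs I x greedyRound s (roundTime n I.formula.numTerms)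
      (if B = 0 then [] else remVars I K (B - 1)) fun s' =>
      if B = 0 then s'.nat 0 0 = s.nat 0 0 ∧ s'.nat 0 1 = 1
      else if ∀ i ∈ I.termAt (B - 1), x i = true then s'.nat 0 0 = 1 ∧ s'.nat 0 1 = 1
      else s'.nat 0 0 = s.nat 0 0 ∧ s'.nat 0 1 = s.nat 0 1 ∧
        Records x (K ∪ I.termAt (B - 1)) s' := by
  set m := I.formula.numTerms with hm
  refine Runs.seq (T₁ := 1) (T₂ := (m * (n * 6 + 9) + 2) + (1 + (1 + (n * 8 + 2) + 3)))
    (l₁ := []) (l₂ := if B = 0 then [] else remVars I K (B - 1)) (Runs.setNat le_rfl ?_)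
    (by rw [roundTime]; omega) rfl
  have hscan := Runs.forBelow (s := s.setNat 6 0 0) (a := 4) (N := m)
    (e := .numTerms) (P := scanTerm) (I := I) (x := x) (B := n * 6 + 7) (fun _ => [])
    (ScanTermInv I x K s) (fun _ => rfl)
    (by
      refine ⟨by simp [Memory.nat_setNat], fun a ha k => ?_, by simp [Memory.nat_setNat, best],
        fun h => absurd rfl h⟩
      rw [Memory.nat_setNat, if_neg (by omega), Memory.nat_setNat, if_neg (by omega)])
    (fun _ _ h => h.1)
    (fun j _ s hs => runs_scanTerm hK j hs)
  rw [List.flatMap_eq_nil_iff.2 (by simp)] at hscan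
  refine Runs.seq (l₁ := []) (l₂ := if B = 0 then [] else remVars I K (B - 1)) (hscan.mono le_rfl fun s₁ hs₁ => ?_) le_rfl rfl
  obtain ⟨-, hf, h6, -⟩ := hs₁
  rw [hB] at h6
  refine Runs.cond (T₁ := 1 + (n * 8 + 2) + 3) (by omega) (fun hc => ?_) fun hc => ?_
  · obtain ⟨b, rfl⟩ : ∃ b, B = b + 1 := by
      refine Nat.exists_eq_succ_of_ne_zero ?_
      rintro rfl
      simp [Cond.Holds, NatExpr.eval, NatExpr.scalar, h6] at hc
    rw [if_neg (Nat.succ_ne_zero b)]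
    simp only [if_neg (Nat.succ_ne_zero b), Nat.add_sub_cancel]
    refine Runs.seq (T₁ := 1) (T₂ := (n * 8 + 2) + 3) (l₁ := []) (l₂ := remVars I K b)
      (Runs.setNat le_rfl ?_) (by omega) rfl
    have hprobe := Runs.forBelow (s := s₁.setNat 7 0 1) (a := 3) (N := n)
      (e := .numVars) (P := probeVariable) (I := I) (x := x) (B := 6)
      (fun i => if h : i < n then
        if (⟨i, h⟩ : Fin n) ∈ I.termAt b \ K then [⟨i, h⟩] else [] else [])
      (ProbeInv I x K b s) (fun _ => rfl)
      (by
        refine ⟨by simp [Memory.nat_setNat], by simpa [Memory.nat_setNat] using h6,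
          by simpa [Memory.nat_setNat] using hf 0 (by decide), by
            simp [Memory.nat_setNat, varsBelow_zero], ?_⟩
        simpa [varsBelow_zero, Records, Memory.nat_setNat, hf] using hK)
      (fun _ _ h => h.1)
      (fun i hi s hs => by
        rw [dif_pos hi]
        exact runs_probeVariable ⟨i, hi⟩ hs)
    rw [flatMap_range_eq_remVars] at hprobe
    refine Runs.seq (l₂ := []) (hprobe.mono le_rfl fun s₂ hs₂ => ?_) le_rfl (by simp)
    obtain ⟨-, -, h0, h7, hK₂⟩ := hs₂
    rw [varsBelow_self, Finset.inter_univ] at hK₂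
    have h7' : s₂.nat 7 0 = if ∀ i ∈ I.termAt b, x i = true then 1 else 0 := by
      rw [h7, varsBelow_self]; simp
    refine Runs.cond (T₁ := 2) le_rfl (fun hc => ?_) fun hc => ?_
    · have hs : ∀ i ∈ I.termAt b, x i = true := by
        by_contra hs
        rw [if_neg hs] at h7'
        simp [Cond.Holds, NatExpr.eval, NatExpr.scalar, h7'] at hc
      refine Runs.seq (T₁ := 1) (T₂ := 1) (l₁ := []) (l₂ := []) (Runs.setNat le_rfl ?_) le_rfl rfl
      refine Runs.setNat le_rfl ?_
      rw [if_pos hs]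
      simp [Memory.nat_setNat, NatExpr.eval]
    · have hs : ¬ ∀ i ∈ I.termAt b, x i = true := by
        intro hs
        rw [if_pos hs] at h7'
        simp [Cond.Holds, NatExpr.eval, NatExpr.scalar, h7'] at hc
      refine Runs.skip (by decide) ?_
      rw [if_neg hs]
      exact ⟨h0 0, h0 1, hK₂⟩
  · obtain rfl : B = 0 := by
      by_contra hB0
      simp [Cond.Holds, NatExpr.eval, NatExpr.scalar, h6, Nat.one_le_iff_ne_zero, hB0] at hc
    rw [if_pos rfl]
    simp only [if_true]
    refine Runs.setNat (by omega) ?_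
    simp [Memory.nat_setNat, NatExpr.eval, hf]

open Classical in
-- The number of live terms is the termination measure. Strict inequality with `r` leaves one round
-- for discovering that no live term remains.
theorem runs_greedyProgram {n : ℕ} (I : Instance n) (x : Fin n → Bool) (r : ℕ)
    (K : Finset (Fin n)) (s : Memory) (hK : Records x K s) (h0 : s.nat 0 0 = 0)
    (h1 : s.nat 0 1 = 0)
    (hr : ((Finset.range I.formula.numTerms).filter fun j => Live I x K j).card < r) :
    Runs I x greedyProgram s (r * (roundTime n I.formula.numTerms + 1) + 1)
      (greedyTests I x r K) fun s' => s'.nat 0 0 = (I.formula.eval x).toNat := by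
  induction r generalizing K s with
  | zero => omega
  | succ r ih =>
    set m := I.formula.numTerms with hm
    have hround := runs_greedyRound (I := I) hK rfl
    rw [← hm] at hround
    have hstart : (Cond.natLE (.cell 0 (.const 1)) (.const 0)).Holds I s := by
      simp [Cond.Holds, NatExpr.eval, h1]
    have h_flag : ∀ s' : Memory, s'.nat 0 1 = 1 →
        ¬ (Cond.natLE (.cell 0 (.const 1)) (.const 0)).Holds I s' := fun s' h => by
      simp [Cond.Holds, NatExpr.eval, h]
    have htime : roundTime n m + (r * (roundTime n m + 1) + 1) + 1 ≤
        (r + 1) * (roundTime n m + 1) + 1 := by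
      rw [Nat.add_mul r 1]; omega
    refine Runs.loop_step hstart (hround.mono le_rfl fun s' hs' => ?_) htime
      (l₂ := if best I x K m = 0 then [] else
        if ∀ i ∈ I.termAt (best I x K m - 1), x i = true then [] else
          greedyTests I x r (K ∪ I.termAt (best I x K m - 1))) ?_
    · by_cases hb : best I x K m = 0
      · rw [if_pos hb] at hs' ⊢
        refine Runs.loop_done (by omega) (h_flag s' hs'.2) ?_
        have hf : I.formula.eval x = false := by
          rw [← Bool.not_eq_true, eval_eq_true_iff]
          rintro ⟨j, hj, hT⟩
          exact best_eq_zero hb j hj fun i hi _ => hT i hi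
        rw [hs'.1, h0, hf]; rfl
      · rw [if_neg hb] at hs' ⊢
        have hlt : best I x K m - 1 < m := by have := best_le I x K m; omega
        by_cases hs : ∀ i ∈ I.termAt (best I x K m - 1), x i = true
        · rw [if_pos hs] at hs' ⊢
          refine Runs.loop_done (by omega) (h_flag s' hs'.2) ?_
          rw [hs'.1, (eval_eq_true_iff I x).2 ⟨_, hlt, hs⟩]; rfl
        · rw [if_neg hs] at hs' ⊢
          refine ih _ s' hs'.2.2 (hs'.1.trans h0) (hs'.2.1.trans h1) ?_
          -- Enlarging `K` revives no term, and the picked term dies because one of its variables,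
          -- now all tested, is false.
          refine (Finset.card_lt_card ?_).trans_le (Nat.le_of_lt_succ hr)
          rw [Finset.ssubset_iff_of_subset]
          · refine ⟨best I x K m - 1, ?_, ?_⟩
            · rw [Finset.mem_filter, Finset.mem_range]
              exact ⟨hlt, (best_spec hb).1⟩
            · rw [Finset.mem_filter]
              exact fun h => hs fun i hi => h.2 i hi (Finset.mem_union_right _ hi)
          · refine Finset.monotone_filter_right _ fun j _ hj i hi hiK => ?_
            exact hj i hi (Finset.mem_union_left _ hiK)
    · rw [greedyTests, ← hm]
      split_ifs <;> simp

/-- A round scans all `m` terms over `n` variables and there are at most `m + 1` rounds, hence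
degree 3; the constant 50 is generous. -/
theorem greedyProgram_time_le (n m : ℕ) :
    (m + 1) * (roundTime n m + 1) + 1 ≤ 50 * (n + m + 1) ^ 3 := by
  rw [roundTime]
  ring_nf
  nlinarith [Nat.zero_le (n * m), Nat.zero_le (n * m ^ 2), Nat.zero_le (n ^ 2 * m)]

theorem greedyProgram_outputs {n : ℕ} (I : Instance n) (x : Fin n → Bool) :
    ∃ t ≤ 50 * (I.size + 1) ^ 3, greedyProgram.Outputs I x (I.formula.eval x) t
      (greedyTests I x (I.formula.numTerms + 1) ∅) := by
  classical
  obtain ⟨s, t, he, ht, h0⟩ := runs_greedyProgram I x (I.formula.numTerms + 1) ∅ Memory.initial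
    (fun i => by simp [Memory.initial]) rfl rfl
    (Nat.lt_succ_of_le ((Finset.card_filter_le _ _).trans_eq (Finset.card_range _)))
  exact ⟨t, ht.trans (greedyProgram_time_le n _), s, he, h0⟩

end SBFE

theorem mainTheorem2 :
    ∃ (P : SBFE.Program) (q : Polynomial ℕ),
      ∀ (n : ℕ) (I : SBFE.Instance n),
        ∃ tests : (Fin n → Bool) → List (Fin n),
          (∀ x : Fin n → Bool, ∃ t : ℕ, t ≤ q.eval I.size ∧
            P.Outputs I x (I.formula.eval x) t (tests x)) ∧
          ∀ k : ℕ, I.formula.IsKDNF k →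
            SBFE.expectation I.prob (fun x => SBFE.testsCost I.cost (tests x)) ≤
              4 / I.rho ^ k *
                SBFE.expectation I.prob
                  (SBFE.minCertificateCost I.formula.eval I.cost) := by
  refine ⟨SBFE.greedyProgram, 50 * (Polynomial.X + 1) ^ 3, fun n I =>
    ⟨fun x => SBFE.greedyTests I x (I.formula.numTerms + 1) ∅, fun x => ?_, fun k hk =>
      SBFE.expectation_greedyTests_le I hk _⟩⟩
  simpa using SBFE.greedyProgram_outputs I x
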